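/- Let $n\le m$ and let $\mathbb X$ be either the space $\mathbb R^{n\times m}$ of real $n\times m$ matrices or the space $\mathbb S^n$ of real symmetric $n\times n$ matrices (in which case $m=n$), equipped with the trace inner product $\langle\cdot,\cdot\rangle$ and the Frobenius norm $\|\cdot\|_F$. For $X\in\mathbb X$ let $\sigma_1(X)\ge\dots\ge\sigma_n(X)\ge 0$ be its singular values, $\|X\|_*=\sum_{i=1}^n\sigma_i(X)$ the nuclear norm, $\|X\|_{(r)}=\sum_{i=1}^r\sigma_i(X)$ the Ky Fan $r$-norm and $\|X\|$ the spectral norm; let $\mathcal B=\{W\in\mathbb X:\|W\|\le 1\}$. Let $\Omega\subseteq\mathbb X$ be closed and let $f:\mathbb X\to(-\infty,+\infty]$ be bounded below, and finite and locally Lipschitz continuous on $\Omega$. Let $\nu>0$. Let $\phi:\mathbb R\to(-\infty,+\infty]$ be a proper lower semicontinuous convex function with $[0,1]\subseteq\operatorname{int}(\operatorname{dom}\phi)$, $\min_{0\le t\le 1}\phi(t)=0$ and $\phi(1)=1$. For $r\in\{1,\dots,n\}$ put $$\Gamma_r=\{X\in\Omega:\operatorname{rank}(X)\le r\},\qquad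 \mathcal S_r(\tau)=\{X\in\Omega:\|X\|_*-\|X\|_{(r)}=\tau\}\quad(\tau\in\mathbb R).$$ Suppose that $f+\delta_\Omega$ is coercive, i.e. $f(X)+\delta_\Omega(X)\to+\infty$ as $\|X\|_F\to\infty$, where $\delta_\Omega$ is $0$ on $\Omega$ and $+\infty$ elsewhere. Suppose also that for every $r\in\{1,\dots,n\}$ the multifunction $\mathcal S_r$ is calm at $0$ for every $\overline X\in\Gamma_r$: there are $\gamma\ge 0$, $\varepsilon>0$ and $\eta>0$ such that for all $\tau$ with $|\tau|\le\varepsilon$, every $X\in\mathcal S_r(\tau)$ with $\|X-\overline X\|_F\le\eta$ lies in $\mathcal S_r(0)+\gamma|\tau|\,\mathbb B_{\mathbb X}$, where $\mathbb B_{\mathbb X}$ is the closed unit ball of $\|\cdot\|_F$. Then the problem $$\min_{X\in\Omega,\;W\in\mathbb X}\Big\{f(X)+\nu\sum_{i=1}^n\phi(\sigma_i(W))\ :\ \|X\|_*-\langle W,X\rangle=0,\ \|W\|\le 1\Big\}$$ (whose constraint says that $X$ lies in the normal cone $\mathcal N_{\mathcal B}(W)$) is partially calm at each of its global optimal solutions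 $(X^*,W^*)$: there exist $\delta>0$ and $\overline\rho>0$ such that for all $\epsilon\ge 0$ and all $(X,W)\in\Omega\times\mathcal B$ with $\|X-X^*\|_F^2+\|W-W^*\|_F^2\le\delta^2$ and $\|X\|_*-\langle X,W\rangle=\epsilon$, $$f(X)+\nu\sum_{i=1}^n\phi(\sigma_i(W))-\Big[f(X^*)+\nu\sum_{i=1}^n\phi(\sigma_i(W^*))\Big]+\overline\rho\,\nu\big(\|X\|_*-\langle X,W\rangle\big)\ge 0.$$ -/

import Mathlib

open scoped Matrix.Norms.Frobenius Pointwise Topology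

noncomputable section

namespace RankReg

/-- The space of real symmetric `n × n` matrices, as a subspace of all `n × n` matrices. -/
def symmetricMatrices (n : ℕ) : Submodule ℝ (Matrix (Fin n) (Fin n) ℝ) where
  carrier := {A | A.IsSymm}
  add_mem' := fun hA hB => Matrix.IsSymm.add hA hB
  zero_mem' := Matrix.isSymm_zero
  smul_mem' := fun c _ hA => Matrix.IsSymm.smul hA c

/-- The two admissible matrix spaces: all real `n × m` matrices with `n ≤ m`, or the symmetric
`n × n` matrices. In both cases the norm is the Frobenius norm. -/
inductive IsMatrixSpace : (n m : ℕ) → Submodule ℝ (Matrix (Fin n) (Fin m) ℝ) → Prop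
  | rectangular {n m : ℕ} (h : n ≤ m) : IsMatrixSpace n m ⊤
  | symmetric (n : ℕ) : IsMatrixSpace n n (symmetricMatrices n)

section Matrices

variable {n m : ℕ}

/-- The `i`-th largest singular value, counted from `i = 0`. -/
def sv (X : Matrix (Fin n) (Fin m) ℝ) (i : ℕ) : ℝ :=
  (Matrix.toEuclideanLin X).singularValues i

/-- The nuclear norm of an `n × m` matrix with `n ≤ m`: the sum of its `n` singular values. -/
def nuclearNorm (X : Matrix (Fin n) (Fin m) ℝ) : ℝ := ∑ i ∈ Finset.range n, sv X i

/-- The Ky Fan `r`-norm: the sum of the `r` largest singular values. -/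
def kyFanNorm (r : ℕ) (X : Matrix (Fin n) (Fin m) ℝ) : ℝ := ∑ i ∈ Finset.range r, sv X i

/-- The spectral norm: the operator norm with respect to the Euclidean norms. -/
def spectralNorm (W : Matrix (Fin n) (Fin m) ℝ) : ℝ :=
  ‖LinearMap.toContinuousLinearMap (Matrix.toEuclideanLin W)‖

/-- The trace inner product `⟨W, X⟩ = tr (Wᵀ X)`. -/
def traceInner (W X : Matrix (Fin n) (Fin m) ℝ) : ℝ := (W.transpose * X).trace

end Matrices

/-- Calmness of a multifunction `M` at `ybar` for `zbar ∈ M ybar`. -/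
def IsCalmAt {Y Z : Type*} [NormedAddCommGroup Y] [NormedAddCommGroup Z] [NormedSpace ℝ Z]
    (M : Y → Set Z) (ybar : Y) (zbar : Z) : Prop :=
  ∃ γ : ℝ, 0 ≤ γ ∧ ∃ ε : ℝ, 0 < ε ∧ ∃ δ : ℝ, 0 < δ ∧
    ∀ y ∈ Metric.closedBall ybar ε,
      M y ∩ Metric.closedBall zbar δ ⊆
        M ybar + (γ * ‖y - ybar‖) • Metric.closedBall (0 : Z) 1

/-- The class of admissible functions `φ : ℝ → (-∞, ∞]`: proper, lower semicontinuous, convex,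
with `[0, 1]` inside the interior of the domain, minimal value `0` on `[0, 1]`, and `φ 1 = 1`. -/
structure IsSurrogate (φ : ℝ → EReal) : Prop where
  ne_bot : ∀ t, φ t ≠ ⊥
  exists_ne_top : ∃ t, φ t ≠ ⊤
  lsc : LowerSemicontinuous φ
  convex_epigraph : Convex ℝ {p : ℝ × ℝ | φ p.1 ≤ (p.2 : EReal)}
  Icc_subset : Set.Icc (0 : ℝ) 1 ⊆ interior {t | φ t < ⊤}
  exists_min : ∃ t ∈ Set.Icc (0 : ℝ) 1, IsMinOn φ (Set.Icc 0 1) t ∧ φ t = 0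
  map_one : φ 1 = 1

section Problem

variable {n m : ℕ} {E : Submodule ℝ (Matrix (Fin n) (Fin m) ℝ)}

/-- `Γ_r`: the points of `Ω` of rank at most `r`. -/
def rankSet (Ω : Set E) (r : ℕ) : Set E :=
  {X | X ∈ Ω ∧ (X : Matrix (Fin n) (Fin m) ℝ).rank ≤ r}

/-- `S_r(τ)`: the points of `Ω` with nuclear norm minus Ky Fan `r`-norm equal to `τ`. -/
def perturbedSet (Ω : Set E) (r : ℕ) (τ : ℝ) : Set E :=
  {X | X ∈ Ω ∧ nuclearNorm (X : Matrix (Fin n) (Fin m) ℝ) - kyFanNorm r X.1 = τ}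

open Classical in
/-- The indicator function of `Ω` in the sense of convex analysis. -/
def indicatorFun (Ω : Set E) (X : E) : EReal := if X ∈ Ω then 0 else ⊤

/-- Coercivity: the function tends to `+∞` as the norm of the argument tends to `+∞`. -/
def IsCoerciveFun (g : E → EReal) : Prop :=
  Filter.Tendsto g (Bornology.cobounded E) (𝓝 ⊤)

/-- `f` is finite and locally Lipschitz on `Ω`. -/
def IsLocallyLipschitzFiniteOn (f : E → EReal) (Ω : Set E) : Prop :=
  (∀ X ∈ Ω, f X ≠ ⊥ ∧ f X ≠ ⊤) ∧ LocallyLipschitzOn Ω (fun X => (f X).toReal)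

/-- The complementarity residual `‖X‖_* - ⟨W, X⟩`. -/
def residual (X W : E) : ℝ := nuclearNorm X.1 - traceInner W.1 X.1

/-- The objective `f(X) + ν ∑ φ(σ_i(W))`. -/
def mpecObjective (f : E → EReal) (ν : ℝ) (φ : ℝ → EReal) (X W : E) : EReal :=
  f X + (ν : EReal) * ∑ i ∈ Finset.range n, φ (sv W.1 i)

/-- The pairs of `Ω × 𝓑` with residual `ε`, where `𝓑` is the spectral norm unit ball; `ε = 0`
gives the feasible set. -/
def mpecFeasible (Ω : Set E) (ε : ℝ) : Set (E × E) :=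
  {p | p.1 ∈ Ω ∧ spectralNorm p.2.1 ≤ 1 ∧ residual p.1 p.2 = ε}

/-- `(Xs, Ws)` is a global optimal solution of the problem of minimizing the objective over the
feasible set. -/
def IsGlobalSolution (Ω : Set E) (f : E → EReal) (ν : ℝ) (φ : ℝ → EReal) (Xs Ws : E) : Prop :=
  (Xs, Ws) ∈ mpecFeasible Ω 0 ∧
    ∀ X W : E, (X, W) ∈ mpecFeasible Ω 0 →
      mpecObjective f ν φ Xs Ws ≤ mpecObjective f ν φ X W

/-- Partial calmness at `(Xs, Ws)`, the ball in the product space being that of the norm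
`(‖X‖² + ‖W‖²)^(1/2)`. -/
def IsPartiallyCalmAt (Ω : Set E) (f : E → EReal) (ν : ℝ) (φ : ℝ → EReal) (Xs Ws : E) : Prop :=
  ∃ δ : ℝ, 0 < δ ∧ ∃ ρ : ℝ, 0 < ρ ∧
    ∀ ε : ℝ, 0 ≤ ε → ∀ X W : E,
      ‖X - Xs‖ ^ 2 + ‖W - Ws‖ ^ 2 ≤ δ ^ 2 →
      (X, W) ∈ mpecFeasible Ω ε →
        0 ≤ mpecObjective f ν φ X W - mpecObjective f ν φ Xs Ws +
          ((ρ * ν * residual X W : ℝ) : EReal)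

end Problem

end RankReg

end

/-!
Let `r` be the rank of `X*` and let `ε = ‖X‖_* - ⟨W, X⟩` be the residual at `(X, W)`. Von Neumann's
trace inequality gives `∑ σ_i(X) (1 - σ_i(W)) ≤ ε`. At a global solution `σ_i(W*) = 1` for the first
`r` indices. For the remaining ones `σ_i(W*)` minimizes `φ` on `[0, 1]`, since only `r` unit
coefficients are needed to make `W` feasible for `X*`; as `φ 1 = 1` is not the minimum,
`σ_i(W*) < 1` there. By continuity of singular values, near `(X*, W*)` the numbers `σ_i(X)`, `i ≤ r`,
and `1 - σ_i(W)`, `i > r`, stay above some `κ > 0`. Hence both the defect `∑_{i ≤ r} (1 - σ_i(W))`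
and the tail `∑_{i > r} σ_i(X)` are at most `ε / κ` (`RankReg.mul_sum_add_sum_le_residual`).

The tail is `‖X‖_* - ‖X‖_(r)`, so calmness gives `Y ∈ Ω` of rank at most `r` with
`‖X - Y‖ ≤ γ ε / κ` (`RankReg.exists_eventually_norm_sub_le`; for `r = 0` one takes `Y = X* = 0`).
Completing `Y` to a feasible pair with penalty `r` shows that `f(Y) + ν r` is at least the optimal
value, and the Lipschitz property bounds `f(X)` below by `f(Y)` up to a multiple of `ε`. The defect,
together with a linear lower bound for the convex function `φ` at `1`, bounds the penalty of `W`
below by `r` up to a multiple of `ε`. Adding the two estimates gives partial calmness.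

The facts about singular values rest on Ky Fan's maximum principle
(`RankReg.sum_inner_dyadicSum_le`), proved for an arbitrary decomposition `∑ d_i u_i v_iᵀ`. It shows
that the coefficients of such a decomposition are the singular values, that singular values are
continuous, and, by Abel summation, von Neumann's inequality.
-/

open scoped RealInnerProductSpace

namespace RankReg

/-! ### Singular value decompositions -/

/-- The matrix `∑ i, d i • u i * (v i)ᵀ`. It is a singular value decomposition when `u` and `v` are
orthonormal and `d` is antitone and nonnegative; only the values `d i` with `i < n` matter. -/
noncomputable def dyadicSum {n m : ℕ} (u : Fin n → EuclideanSpace ℝ (Fin n))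
    (v : Fin n → EuclideanSpace ℝ (Fin m)) (d : ℕ → ℝ) : Matrix (Fin n) (Fin m) ℝ :=
  ∑ i : Fin n, d i • Matrix.vecMulVec (u i).ofLp (v i).ofLp

section Dyadic

variable {n m : ℕ} {u : Fin n → EuclideanSpace ℝ (Fin n)} {v : Fin n → EuclideanSpace ℝ (Fin m)}

lemma toEuclideanLin_dyadicSum (d : ℕ → ℝ) (x : EuclideanSpace ℝ (Fin m)) :
    Matrix.toEuclideanLin (dyadicSum u v d) x = ∑ i : Fin n, (d i * ⟪v i, x⟫) • u i := by
  unfold dyadicSum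
  rw [map_sum, LinearMap.sum_apply]
  refine Finset.sum_congr rfl fun i _ => ?_
  rw [map_smul, LinearMap.smul_apply, mul_smul]
  congr 1
  ext j
  simp [Matrix.toLpLin_apply, Matrix.vecMulVec_mulVec, EuclideanSpace.inner_eq_star_dotProduct,
    dotProduct_comm]

lemma traceInner_dyadicSum (W : Matrix (Fin n) (Fin m) ℝ) (d : ℕ → ℝ) :
    traceInner W (dyadicSum u v d) =
      ∑ i : Fin n, d i * ⟪Matrix.toEuclideanLin W (v i), u i⟫ := by
  unfold traceInner dyadicSum
  rw [Matrix.mul_sum, Matrix.trace_sum]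
  refine Finset.sum_congr rfl fun i _ => ?_
  rw [Matrix.mul_smul, Matrix.trace_smul, Matrix.mul_vecMulVec, Matrix.trace_vecMulVec, smul_eq_mul,
    EuclideanSpace.inner_eq_star_dotProduct]
  congr 1
  rw [Matrix.toLpLin_apply, Matrix.mulVec_transpose, ← Matrix.dotProduct_mulVec]
  simp

lemma toEuclideanLin_dyadicSum_apply (hv : Orthonormal ℝ v) (d : ℕ → ℝ) (j : Fin n) :
    Matrix.toEuclideanLin (dyadicSum u v d) (v j) = d j • u j := by
  classical
  rw [toEuclideanLin_dyadicSum, Finset.sum_eq_single j]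
  · simp [hv.1 j]
  · intro i _ hij
    simp [hv.2 hij]
  · simp

/-- Ky Fan's maximum principle: the sum of the `k` largest coefficients of a singular value
decomposition bounds every sum of `k` bilinear values on orthonormal families. The coefficient `d i`
enters the latter with a weight `∑ j, ⟪v i, y j⟫ ⟪x j, u i⟫`; these weights are at most `1` and add
up to at most `k`, by Bessel's inequality. -/
lemma sum_inner_dyadicSum_le (hu : Orthonormal ℝ u) (hv : Orthonormal ℝ v) {d : ℕ → ℝ}
    (hd : Antitone d) (hd0 : ∀ i, 0 ≤ d i) {k : ℕ} (hk : k ≤ n)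
    {x : Fin k → EuclideanSpace ℝ (Fin n)} {y : Fin k → EuclideanSpace ℝ (Fin m)}
    (hx : Orthonormal ℝ x) (hy : Orthonormal ℝ y) :
    ∑ j, ⟪Matrix.toEuclideanLin (dyadicSum u v d) (y j), x j⟫ ≤ ∑ i ∈ Finset.range k, d i := by
  set c : Fin n → ℝ := fun i => ∑ j, (⟪v i, y j⟫ ^ 2 + ⟪x j, u i⟫ ^ 2) / 2 with hc
  have hc0 : ∀ i, 0 ≤ c i := fun i => Finset.sum_nonneg fun j _ => by positivity
  have hc1 : ∀ i, c i ≤ 1 := by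
    intro i
    have h1 := hy.sum_inner_products_le (v i) (s := Finset.univ)
    have h2 := hx.sum_inner_products_le (u i) (s := Finset.univ)
    simp only [Real.norm_eq_abs, sq_abs, hu.1, hv.1, one_pow] at h1 h2
    have h3 : c i = ((∑ j, ⟪y j, v i⟫ ^ 2) + ∑ j, ⟪x j, u i⟫ ^ 2) / 2 := by
      rw [hc, ← Finset.sum_add_distrib, Finset.sum_div]
      simp only [real_inner_comm]
    linarith
  have hcs : ∑ i, c i ≤ k := by
    rw [hc, Finset.sum_comm]
    calc _ ≤ ∑ j : Fin k, (1 : ℝ) := by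
          refine Finset.sum_le_sum fun j _ => ?_
          have h1 := hv.sum_inner_products_le (y j) (s := Finset.univ)
          have h2 := hu.sum_inner_products_le (x j) (s := Finset.univ)
          simp only [Real.norm_eq_abs, sq_abs, hx.1, hy.1, one_pow] at h1 h2
          rw [← Finset.sum_div, Finset.sum_add_distrib]
          have h3 : ∑ i, ⟪x j, u i⟫ ^ 2 = ∑ i, ⟪u i, x j⟫ ^ 2 := by simp only [real_inner_comm]
          linarith
      _ = k := by simp
  have hsum : ∑ j, ⟪Matrix.toEuclideanLin (dyadicSum u v d) (y j), x j⟫ ≤ ∑ i : Fin n, d i * c i := by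
    simp only [toEuclideanLin_dyadicSum, sum_inner, inner_smul_left, RCLike.conj_to_real, hc,
      Finset.mul_sum]
    rw [Finset.sum_comm]
    refine Finset.sum_le_sum fun i _ => Finset.sum_le_sum fun j _ => ?_
    rw [mul_assoc]
    refine mul_le_mul_of_nonneg_left ?_ (hd0 _)
    rw [real_inner_comm (u i) (x j)]
    nlinarith [sq_nonneg (⟪v i, y j⟫ - ⟪u i, x j⟫)]
  refine hsum.trans ?_
  -- Comparing each coefficient with the threshold `d k`, the first `k` weights may be raised to `1`.
  have hterm : ∀ i : Fin n, d i * c i ≤ d k * c i + if (i : ℕ) < k then d i - d k else 0 := by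
    intro i
    split_ifs with h
    · nlinarith [hd h.le, hc1 i]
    · nlinarith [hd (not_lt.1 h), hc0 i]
  calc ∑ i : Fin n, d i * c i
      ≤ ∑ i : Fin n, (d k * c i + if (i : ℕ) < k then d i - d k else 0) :=
        Finset.sum_le_sum fun i _ => hterm i
    _ = d k * ∑ i, c i + ∑ i ∈ Finset.range k, (d i - d k) := by
        rw [Finset.sum_add_distrib, Finset.mul_sum,
          ← Finset.sum_range (fun i => if i < k then d i - d k else 0), ← Finset.sum_filter]
        congr 2
        ext i
        simp only [Finset.mem_filter, Finset.mem_range]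
        omega
    _ ≤ d k * k + ∑ i ∈ Finset.range k, (d i - d k) := by
        gcongr
        exact hd0 k
    _ = ∑ i ∈ Finset.range k, d i := by
        rw [Finset.sum_sub_distrib]
        simp
        ring

/-- Restricting orthonormal families of singular vectors to the first `k` indices attains Ky Fan's
bound. -/
lemma sum_inner_dyadicSum_castLE (hu : Orthonormal ℝ u) (hv : Orthonormal ℝ v) (d : ℕ → ℝ)
    {k : ℕ} (hk : k ≤ n) :
    ∑ j : Fin k, ⟪Matrix.toEuclideanLin (dyadicSum u v d) (v (Fin.castLE hk j)),
      u (Fin.castLE hk j)⟫ = ∑ i ∈ Finset.range k, d i := by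
  rw [Finset.sum_range]
  refine Finset.sum_congr rfl fun j _ => ?_
  rw [toEuclideanLin_dyadicSum_apply hv, inner_smul_left]
  simp [hu.1]

lemma sv_nonneg (X : Matrix (Fin n) (Fin m) ℝ) (i : ℕ) : 0 ≤ sv X i :=
  LinearMap.singularValues_nonneg _ i

lemma sv_antitone (X : Matrix (Fin n) (Fin m) ℝ) : Antitone (sv X) :=
  LinearMap.singularValues_antitone _

lemma rank_eq_finrank_range_toEuclideanLin (X : Matrix (Fin n) (Fin m) ℝ) :
    X.rank = Module.finrank ℝ (Matrix.toEuclideanLin X).range := by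
  rw [Matrix.toEuclideanLin_eq_toLin_orthonormal]
  exact X.rank_eq_finrank_range_toLin _ _

lemma sv_eq_zero_iff {X : Matrix (Fin n) (Fin m) ℝ} {i : ℕ} : sv X i = 0 ↔ X.rank ≤ i := by
  rw [rank_eq_finrank_range_toEuclideanLin]
  exact LinearMap.singularValues_eq_zero_iff_le_finrank_range _

end Dyadic

/-- Existence of a singular value decomposition. The right singular vectors are the first `n`
eigenvectors of `Xᵀ X`; their images are orthogonal, and the nonzero ones, normalized, extend to an
orthonormal basis of left singular vectors. -/
lemma exists_eq_dyadicSum_sv {n m : ℕ} (hnm : n ≤ m) (X : Matrix (Fin n) (Fin m) ℝ) :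
    ∃ u : Fin n → EuclideanSpace ℝ (Fin n), ∃ v : Fin n → EuclideanSpace ℝ (Fin m),
      Orthonormal ℝ u ∧ Orthonormal ℝ v ∧ X = dyadicSum u v (sv X) := by
  classical
  set T := Matrix.toEuclideanLin X with hT
  have hm : Module.finrank ℝ (EuclideanSpace ℝ (Fin m)) = m := by simp
  set b := T.isSymmetric_adjoint_comp_self.eigenvectorBasis hm with hb
  have hinner : ∀ i j, ⟪T (b i), T (b j)⟫ = if i = j then sv X i ^ 2 else 0 := by
    intro i j
    have h1 : ⟪T (b i), T (b j)⟫ = ⟪(LinearMap.adjoint T ∘ₗ T) (b i), b j⟫ := by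
      rw [LinearMap.comp_apply, LinearMap.adjoint_inner_left]
    rw [h1, hb, LinearMap.IsSymmetric.apply_eigenvectorBasis, ← hb, inner_smul_left,
      orthonormal_iff_ite.1 b.orthonormal i j]
    have h2 : sv X i ^ 2 = _ := T.sq_singularValues_fin hm i
    rw [h2]
    split_ifs <;> simp
  have hzero : ∀ i : Fin m, sv X i = 0 → T (b i) = 0 := by
    intro i hi
    have := hinner i i
    rw [if_pos rfl, hi] at this
    exact inner_self_eq_zero.1 (this.trans (by norm_num))
  set v : Fin n → EuclideanSpace ℝ (Fin m) := fun i => b (Fin.castLE hnm i) with hv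
  have hvo : Orthonormal ℝ v := b.orthonormal.comp _ (Fin.castLE_injective hnm)
  set s : Set (Fin n) := {i | sv X i ≠ 0} with hs
  have hu0 : Orthonormal ℝ (s.domRestrict fun i : Fin n => (sv X i)⁻¹ • T (v i)) := by
    rw [orthonormal_iff_ite]
    rintro ⟨i, hi⟩ ⟨j, hj⟩
    simp only [Set.domRestrict_apply, inner_smul_left, inner_smul_right, hv, hinner,
      RCLike.conj_to_real, Subtype.mk.injEq]
    by_cases hij : i = j
    · subst hij
      have : sv X i ≠ 0 := hi
      simp
      field_simp
    · simp [hij]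
  obtain ⟨u, hu⟩ := hu0.exists_orthonormalBasis_extension_of_card_eq (by simp)
  refine ⟨u, v, u.orthonormal, hvo, ?_⟩
  apply Matrix.toEuclideanLin.injective
  refine b.toBasis.ext fun j => ?_
  rw [OrthonormalBasis.coe_toBasis]
  by_cases hj : (j : ℕ) < n
  · have hjv : b j = v ⟨j, hj⟩ := rfl
    rw [hjv, toEuclideanLin_dyadicSum_apply hvo]
    by_cases h0 : sv X j = 0
    · rw [← hjv]
      exact (hzero j h0).trans (by simp [h0])
    · rw [hu ⟨j, hj⟩ h0, smul_smul, mul_inv_cancel₀ h0, one_smul]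
  · have h0 : sv X j = 0 := sv_eq_zero_iff.2 (by
      have := X.rank_le_card_height
      simp at this
      omega)
    rw [toEuclideanLin_dyadicSum]
    refine (hzero j h0).trans (Finset.sum_eq_zero fun i _ => ?_).symm
    have hij : Fin.castLE hnm i ≠ j := by
      rintro rfl
      exact hj i.2
    simp [hv, b.orthonormal.2 hij]

section SingularValues

variable {n m : ℕ} {u : Fin n → EuclideanSpace ℝ (Fin n)} {v : Fin n → EuclideanSpace ℝ (Fin m)}

lemma sum_inner_le_kyFanNorm (hnm : n ≤ m) (X : Matrix (Fin n) (Fin m) ℝ) {k : ℕ} (hk : k ≤ n)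
    {x : Fin k → EuclideanSpace ℝ (Fin n)} {y : Fin k → EuclideanSpace ℝ (Fin m)}
    (hx : Orthonormal ℝ x) (hy : Orthonormal ℝ y) :
    ∑ j, ⟪Matrix.toEuclideanLin X (y j), x j⟫ ≤ kyFanNorm k X := by
  obtain ⟨u, v, hu, hv, h⟩ := exists_eq_dyadicSum_sv hnm X
  have := sum_inner_dyadicSum_le hu hv (sv_antitone X) (sv_nonneg X) hk hx hy
  rwa [← h] at this

lemma exists_sum_inner_eq_kyFanNorm (hnm : n ≤ m) (X : Matrix (Fin n) (Fin m) ℝ) {k : ℕ}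
    (hk : k ≤ n) :
    ∃ x : Fin k → EuclideanSpace ℝ (Fin n), ∃ y : Fin k → EuclideanSpace ℝ (Fin m),
      Orthonormal ℝ x ∧ Orthonormal ℝ y ∧
        ∑ j, ⟪Matrix.toEuclideanLin X (y j), x j⟫ = kyFanNorm k X := by
  obtain ⟨u, v, hu, hv, h⟩ := exists_eq_dyadicSum_sv hnm X
  refine ⟨_, _, hu.comp _ (Fin.castLE_injective hk), hv.comp _ (Fin.castLE_injective hk), ?_⟩
  have := sum_inner_dyadicSum_castLE hu hv (sv X) hk
  rwa [← h] at this

lemma kyFanNorm_dyadicSum (hnm : n ≤ m) (hu : Orthonormal ℝ u) (hv : Orthonormal ℝ v) {d : ℕ → ℝ}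
    (hd : Antitone d) (hd0 : ∀ i, 0 ≤ d i) {k : ℕ} (hk : k ≤ n) :
    kyFanNorm k (dyadicSum u v d) = ∑ i ∈ Finset.range k, d i := by
  refine le_antisymm ?_ ?_
  · obtain ⟨x, y, hx, hy, h⟩ := exists_sum_inner_eq_kyFanNorm hnm (dyadicSum u v d) hk
    rw [← h]
    exact sum_inner_dyadicSum_le hu hv hd hd0 hk hx hy
  · rw [← sum_inner_dyadicSum_castLE hu hv d hk]
    exact sum_inner_le_kyFanNorm hnm _ hk (hu.comp _ (Fin.castLE_injective hk))
      (hv.comp _ (Fin.castLE_injective hk))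

lemma sv_eq_kyFanNorm_sub (X : Matrix (Fin n) (Fin m) ℝ) (i : ℕ) :
    sv X i = kyFanNorm (i + 1) X - kyFanNorm i X := by
  simp [kyFanNorm, Finset.sum_range_succ]

/-- The coefficients of a singular value decomposition are the singular values. -/
lemma sv_dyadicSum (hnm : n ≤ m) (hu : Orthonormal ℝ u) (hv : Orthonormal ℝ v) {d : ℕ → ℝ}
    (hd : Antitone d) (hd0 : ∀ i, 0 ≤ d i) {i : ℕ} (hi : i < n) :
    sv (dyadicSum u v d) i = d i := by
  rw [sv_eq_kyFanNorm_sub, kyFanNorm_dyadicSum hnm hu hv hd hd0 hi,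
    kyFanNorm_dyadicSum hnm hu hv hd hd0 hi.le, Finset.sum_range_succ]
  ring

lemma dyadicSum_congr {d d' : ℕ → ℝ} (h : ∀ i < n, d i = d' i) :
    dyadicSum u v d = dyadicSum u v d' :=
  Finset.sum_congr rfl fun i _ => by rw [h i i.2]

end SingularValues

/-- A symmetric matrix has a singular value decomposition whose left singular vectors are, up to
sign, its right singular vectors: sort an orthonormal eigenbasis by the absolute value of the
eigenvalues. -/
lemma exists_eq_dyadicSum_sv_of_isSymm {n : ℕ} {X : Matrix (Fin n) (Fin n) ℝ} (hX : X.IsSymm) :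
    ∃ (s : Fin n → ℝ) (u v : Fin n → EuclideanSpace ℝ (Fin n)), (∀ i, u i = s i • v i) ∧
      Orthonormal ℝ u ∧ Orthonormal ℝ v ∧ X = dyadicSum u v (sv X) := by
  classical
  have hH : X.IsHermitian := Matrix.isHermitian_iff_isSymm.2 hX
  set q := hH.eigenvectorBasis
  set l := hH.eigenvalues with hl
  set p := Tuple.sort fun i => -|l i|
  have hp : Monotone fun i => -|l (p i)| := Tuple.monotone_sort fun i => -|l i|
  set v : Fin n → EuclideanSpace ℝ (Fin n) := fun i => q (p i) with hv
  have hvo : Orthonormal ℝ v := q.orthonormal.comp _ p.injective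
  set s : Fin n → ℝ := fun i => if l (p i) < 0 then -1 else 1 with hs
  have hs2 : ∀ i, s i * s i = 1 := fun i => by simp only [hs]; split_ifs <;> norm_num
  have hsl : ∀ i, |l (p i)| * s i = l (p i) := by
    intro i
    simp only [hs]
    split_ifs with h
    · rw [abs_of_neg h]; ring
    · rw [abs_of_nonneg (not_lt.1 h)]; ring
  have huo : Orthonormal ℝ fun i => s i • v i := by
    rw [orthonormal_iff_ite] at hvo ⊢
    intro i j
    rw [inner_smul_left, inner_smul_right, hvo]
    split_ifs with h
    · subst h
      simpa using hs2 i
    · simp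
  set d : ℕ → ℝ := fun k => if h : k < n then |l (p ⟨k, h⟩)| else 0 with hd
  have hd0 : ∀ k, 0 ≤ d k := by
    intro k
    simp only [hd]
    split_ifs <;> positivity
  have hda : Antitone d := by
    intro a c hac
    by_cases hc : c < n
    · have ha : a < n := hac.trans_lt hc
      simp only [hd, ha, hc, dif_pos]
      simpa using hp (show (⟨a, ha⟩ : Fin n) ≤ ⟨c, hc⟩ from hac)
    · simpa [hd, hc] using hd0 a
  have hXd : X = dyadicSum (fun i => s i • v i) v d := by
    apply Matrix.toEuclideanLin.injective
    refine q.toBasis.ext fun j => ?_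
    rw [OrthonormalBasis.coe_toBasis]
    have hj : q j = v (p.symm j) := by simp [hv]
    have hdj : d (p.symm j) = |l (p (p.symm j))| := by simp [hd]
    rw [hj, toEuclideanLin_dyadicSum_apply hvo, hdj, smul_smul, hsl, ← hj]
    have := hH.mulVec_eigenvectorBasis j
    rw [Matrix.toLpLin_apply]
    ext k
    simpa [hl] using congrFun this k
  refine ⟨s, _, v, fun i => rfl, huo, hvo, hXd.trans (dyadicSum_congr fun i hi => ?_)⟩
  conv_rhs => rw [hXd]
  exact (sv_dyadicSum le_rfl huo hvo hda hd0 hi).symm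

lemma IsMatrixSpace.le {n m : ℕ} {E : Submodule ℝ (Matrix (Fin n) (Fin m) ℝ)}
    (hE : IsMatrixSpace n m E) : n ≤ m := by
  cases hE with
  | rectangular h => exact h
  | symmetric => exact le_rfl

/-- Each matrix of an admissible space has a singular value decomposition whose singular vectors,
combined with any other coefficients, give a matrix of the same space. -/
lemma IsMatrixSpace.exists_eq_dyadicSum_sv {n m : ℕ} {E : Submodule ℝ (Matrix (Fin n) (Fin m) ℝ)}
    (hE : IsMatrixSpace n m E) {X : Matrix (Fin n) (Fin m) ℝ} (hX : X ∈ E) :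
    ∃ u : Fin n → EuclideanSpace ℝ (Fin n), ∃ v : Fin n → EuclideanSpace ℝ (Fin m),
      Orthonormal ℝ u ∧ Orthonormal ℝ v ∧ X = dyadicSum u v (sv X) ∧
        ∀ d : ℕ → ℝ, dyadicSum u v d ∈ E := by
  cases hE with
  | rectangular h =>
    obtain ⟨u, v, hu, hv, h⟩ := RankReg.exists_eq_dyadicSum_sv h X
    exact ⟨u, v, hu, hv, h, fun _ => Submodule.mem_top⟩
  | symmetric =>
    obtain ⟨s, u, v, hs, hu, hv, h⟩ := exists_eq_dyadicSum_sv_of_isSymm hX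
    refine ⟨u, v, hu, hv, h, fun d => Submodule.sum_mem _ fun i _ => Submodule.smul_mem _ _ ?_⟩
    change Matrix.transpose _ = _
    rw [Matrix.transpose_vecMulVec, hs i]
    ext a b
    simp [Matrix.vecMulVec_apply]
    ring

/-! ### Norms, continuity and trace inequalities -/

section Inequalities

variable {n m : ℕ}

lemma inner_toEuclideanLin_le_spectralNorm (W : Matrix (Fin n) (Fin m) ℝ)
    {x : EuclideanSpace ℝ (Fin n)} {y : EuclideanSpace ℝ (Fin m)} (hx : ‖x‖ = 1) (hy : ‖y‖ = 1) :
    ⟪Matrix.toEuclideanLin W y, x⟫ ≤ spectralNorm W := by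
  have h1 := real_inner_le_norm (Matrix.toEuclideanLin W y) x
  have h2 := (LinearMap.toContinuousLinearMap (Matrix.toEuclideanLin W)).le_opNorm y
  rw [hx, mul_one] at h1
  rw [hy, mul_one] at h2
  exact h1.trans h2

lemma continuous_spectralNorm :
    Continuous (spectralNorm : Matrix (Fin n) (Fin m) ℝ → ℝ) :=
  continuous_norm.comp (LinearMap.continuous_of_finiteDimensional
    (LinearMap.toContinuousLinearMap.toLinearMap ∘ₗ
      (Matrix.toEuclideanLin (𝕜 := ℝ) (m := Fin n) (n := Fin m)).toLinearMap))

lemma kyFanNorm_le_add_spectralNorm_sub (hnm : n ≤ m) (X Y : Matrix (Fin n) (Fin m) ℝ) {k : ℕ}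
    (hk : k ≤ n) : kyFanNorm k X ≤ kyFanNorm k Y + k * spectralNorm (X - Y) := by
  obtain ⟨x, y, hx, hy, h⟩ := exists_sum_inner_eq_kyFanNorm hnm X hk
  have h1 : ∑ j, ⟪Matrix.toEuclideanLin (X - Y) (y j), x j⟫ ≤ k * spectralNorm (X - Y) := by
    calc _ ≤ ∑ _j : Fin k, spectralNorm (X - Y) := Finset.sum_le_sum fun j _ =>
          inner_toEuclideanLin_le_spectralNorm _ (hx.1 j) (hy.1 j)
      _ = _ := by simp
  have h2 := sum_inner_le_kyFanNorm hnm Y hk hx hy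
  simp only [map_sub, LinearMap.sub_apply, inner_sub_left, Finset.sum_sub_distrib] at h1
  linarith

lemma continuous_kyFanNorm (hnm : n ≤ m) {k : ℕ} (hk : k ≤ n) :
    Continuous (kyFanNorm k : Matrix (Fin n) (Fin m) ℝ → ℝ) := by
  refine continuous_iff_continuousAt.2 fun X => tendsto_iff_norm_sub_tendsto_zero.2 ?_
  have h0 : spectralNorm (0 : Matrix (Fin n) (Fin m) ℝ) = 0 := by simp [spectralNorm]
  have hlim : ∀ g : Matrix (Fin n) (Fin m) ℝ → Matrix (Fin n) (Fin m) ℝ, Continuous g → g X = 0 →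
      Filter.Tendsto (fun Y => k * spectralNorm (g Y)) (𝓝 X) (𝓝 0) := by
    intro g hg hgX
    have := (continuous_const.mul (continuous_spectralNorm.comp hg)).tendsto (f := fun Y =>
      (k : ℝ) * spectralNorm (g Y)) X
    simpa [hgX, h0] using this
  have hsum := (hlim (fun Y => Y - X) (by fun_prop) (by simp)).add
    (hlim (fun Y => X - Y) (by fun_prop) (by simp))
  rw [add_zero] at hsum
  refine squeeze_zero (fun _ => norm_nonneg _) (fun Y => ?_) hsum
  have h1 := kyFanNorm_le_add_spectralNorm_sub hnm X Y hk
  have h2 := kyFanNorm_le_add_spectralNorm_sub hnm Y X hk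
  have h3 : ∀ Z : Matrix (Fin n) (Fin m) ℝ, 0 ≤ k * spectralNorm Z := fun Z =>
    mul_nonneg (Nat.cast_nonneg _) (norm_nonneg _)
  rw [Real.norm_eq_abs, abs_le]
  constructor <;> linarith [h3 (X - Y), h3 (Y - X)]

lemma continuous_sv (hnm : n ≤ m) {i : ℕ} (hi : i < n) :
    Continuous fun X : Matrix (Fin n) (Fin m) ℝ => sv X i := by
  simp only [sv_eq_kyFanNorm_sub]
  exact (continuous_kyFanNorm hnm hi).sub (continuous_kyFanNorm hnm hi.le)

lemma sv_le_spectralNorm (hnm : n ≤ m) (W : Matrix (Fin n) (Fin m) ℝ) {i : ℕ} (hi : i < n) :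
    sv W i ≤ spectralNorm W := by
  obtain ⟨u, v, hu, hv, h⟩ := exists_eq_dyadicSum_sv hnm W
  have h1 := toEuclideanLin_dyadicSum_apply (u := u) hv (sv W) ⟨i, hi⟩
  rw [← h] at h1
  have h2 := inner_toEuclideanLin_le_spectralNorm W (hu.1 ⟨i, hi⟩) (hv.1 ⟨i, hi⟩)
  rw [h1, inner_smul_left] at h2
  simpa [hu.1] using h2

lemma spectralNorm_dyadicSum_le_one {u : Fin n → EuclideanSpace ℝ (Fin n)}
    {v : Fin n → EuclideanSpace ℝ (Fin m)} (hu : Orthonormal ℝ u) (hv : Orthonormal ℝ v)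
    {d : ℕ → ℝ} (hd : ∀ i, d i ∈ Set.Icc (0 : ℝ) 1) : spectralNorm (dyadicSum u v d) ≤ 1 := by
  refine ContinuousLinearMap.opNorm_le_bound _ zero_le_one fun x => ?_
  rw [one_mul, LinearMap.coe_toContinuousLinearMap', toEuclideanLin_dyadicSum]
  refine le_of_sq_le_sq ?_ (norm_nonneg _)
  have h1 := hv.sum_inner_products_le x (s := Finset.univ)
  rw [← real_inner_self_eq_norm_sq, hu.inner_sum]
  refine le_trans (Finset.sum_le_sum fun i _ => ?_) h1
  simp only [RCLike.conj_to_real, Real.norm_eq_abs, sq_abs]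
  have h2 : d i ^ 2 ≤ 1 := pow_le_one₀ (hd i).1 (hd i).2
  nlinarith [sq_nonneg ⟪v i, x⟫]

lemma norm_le_nuclearNorm (hnm : n ≤ m) (X : Matrix (Fin n) (Fin m) ℝ) : ‖X‖ ≤ nuclearNorm X := by
  obtain ⟨u, v, hu, hv, h⟩ := exists_eq_dyadicSum_sv hnm X
  rw [nuclearNorm, Finset.sum_range]
  conv_lhs => rw [h]
  refine norm_sum_le_of_le _ fun i _ => ?_
  have h1 : ‖Matrix.vecMulVec (u i).ofLp (v i).ofLp‖ ≤ 1 := by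
    rw [Matrix.vecMulVec_eq Unit]
    refine (Matrix.frobenius_norm_mul _ _).trans ?_
    rw [Matrix.frobenius_norm_replicateCol, Matrix.frobenius_norm_replicateRow]
    simp [hu.1, hv.1]
  rw [norm_smul, Real.norm_of_nonneg (sv_nonneg X i)]
  exact mul_le_of_le_one_right (sv_nonneg X i) h1

lemma nuclearNorm_sub_kyFanNorm {r : ℕ} (hr : r ≤ n) (X : Matrix (Fin n) (Fin m) ℝ) :
    nuclearNorm X - kyFanNorm r X = ∑ i ∈ Finset.Ico r n, sv X i := by
  rw [nuclearNorm, kyFanNorm, Finset.sum_Ico_eq_sub _ hr]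

end Inequalities

/-- Abel summation: nonnegative partial sums stay nonnegative under decreasing weights. -/
lemma sum_mul_nonneg_of_antitone {a x : ℕ → ℝ} (ha : Antitone a) (ha0 : ∀ i, 0 ≤ a i) {N : ℕ}
    (hx : ∀ k ≤ N, 0 ≤ ∑ i ∈ Finset.range k, x i) :
    0 ≤ ∑ i ∈ Finset.range N, a i * x i := by
  have key : ∀ k ≤ N, a k * ∑ i ∈ Finset.range k, x i ≤ ∑ i ∈ Finset.range k, a i * x i := by
    intro k
    induction k with
    | zero => simp
    | succ k ih =>
      intro hk
      have h1 := ih (Nat.le_of_succ_le hk)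
      have h2 := mul_le_mul_of_nonneg_right (ha (Nat.le_succ k)) (hx (k + 1) hk)
      rw [Finset.sum_range_succ] at h2 ⊢
      rw [Finset.sum_range_succ]
      nlinarith
  exact (mul_nonneg (ha0 N) (hx N le_rfl)).trans (key N le_rfl)

/-- Von Neumann's trace inequality. By Ky Fan's principle the partial sums of the diagonal of `W`
with respect to the singular vectors of `X` are at most those of the singular values of `W`. -/
lemma traceInner_le_sum_sv_mul_sv {n m : ℕ} (hnm : n ≤ m) (W X : Matrix (Fin n) (Fin m) ℝ) :
    traceInner W X ≤ ∑ i ∈ Finset.range n, sv X i * sv W i := by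
  obtain ⟨u, v, hu, hv, h⟩ := exists_eq_dyadicSum_sv hnm X
  set x : ℕ → ℝ := fun i => if hi : i < n then
    ⟪Matrix.toEuclideanLin W (v ⟨i, hi⟩), u ⟨i, hi⟩⟫ else 0 with hx
  have h1 : traceInner W X = ∑ i ∈ Finset.range n, sv X i * x i := by
    conv_lhs => rw [h]
    rw [traceInner_dyadicSum, Finset.sum_range]
    simp [hx]
  have h2 : 0 ≤ ∑ i ∈ Finset.range n, sv X i * (sv W i - x i) := by
    refine sum_mul_nonneg_of_antitone (sv_antitone X) (sv_nonneg X) fun k hk => ?_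
    rw [Finset.sum_sub_distrib, sub_nonneg]
    have := sum_inner_le_kyFanNorm hnm W hk (hu.comp _ (Fin.castLE_injective hk))
      (hv.comp _ (Fin.castLE_injective hk))
    refine le_of_eq_of_le ?_ this
    rw [Finset.sum_range]
    refine Finset.sum_congr rfl fun i _ => ?_
    simp [hx, i.2.trans_le hk, Fin.castLE]
  simp only [mul_sub, Finset.sum_sub_distrib] at h2
  linarith

lemma sum_sv_mul_one_sub_sv_le_residual {n m : ℕ} {E : Submodule ℝ (Matrix (Fin n) (Fin m) ℝ)}
    (hnm : n ≤ m) (X W : E) :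
    ∑ i ∈ Finset.range n, sv X.1 i * (1 - sv W.1 i) ≤ residual X W := by
  have := traceInner_le_sum_sv_mul_sv hnm W.1 X.1
  simp only [mul_sub, mul_one, Finset.sum_sub_distrib, residual, nuclearNorm]
  linarith

/-! ### The surrogate and the objective -/

namespace IsSurrogate

variable {φ : ℝ → EReal}

lemma coe_toReal (hφ : IsSurrogate φ) {t : ℝ} (ht : t ∈ Set.Icc (0 : ℝ) 1) :
    ((φ t).toReal : EReal) = φ t :=
  EReal.coe_toReal (interior_subset (hφ.Icc_subset ht)).ne (hφ.ne_bot t)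

lemma toReal_one (hφ : IsSurrogate φ) : (φ 1).toReal = 1 := by simp [hφ.map_one]

lemma toReal_nonneg (hφ : IsSurrogate φ) {t : ℝ} (ht : t ∈ Set.Icc (0 : ℝ) 1) :
    0 ≤ (φ t).toReal := by
  obtain ⟨s, hs, hmin, h0⟩ := hφ.exists_min
  exact EReal.toReal_nonneg (h0 ▸ hmin ht)

/-- A linear lower bound at `1`: the function is finite at some `t > 1`, and `1` lies between `w`
and `t`. -/
lemma exists_one_sub_le (hφ : IsSurrogate φ) :
    ∃ L : ℝ, 0 ≤ L ∧ ∀ w ∈ Set.Icc (0 : ℝ) 1, 1 - L * (1 - w) ≤ (φ w).toReal := by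
  have h1 : {t | φ t < ⊤} ∈ 𝓝 (1 : ℝ) := mem_interior_iff_mem_nhds.1 (hφ.Icc_subset (by simp))
  obtain ⟨e, he, hball⟩ := Metric.mem_nhds_iff.1 h1
  obtain ⟨k, hk, ht⟩ : ∃ k > 0, φ (1 + k) < ⊤ := ⟨e / 2, half_pos he, hball (by
    rw [Metric.mem_ball, Real.dist_eq, add_sub_cancel_left, abs_of_pos (half_pos he)]
    linarith)⟩
  set c := (φ (1 + k)).toReal
  have hc : φ (1 + k) ≤ (c : EReal) := EReal.le_coe_toReal ht.ne
  refine ⟨|c - 1| / k, by positivity, fun w hw => ?_⟩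
  set p := (φ w).toReal
  have hp : φ w ≤ (p : EReal) := (hφ.coe_toReal hw).ge
  have hD : 0 < 1 - w + k := by linarith [hw.2]
  have hD0 := hD.ne'
  have hconv := hφ.convex_epigraph (x := (w, p)) hp (y := (1 + k, c)) hc
    (a := k / (1 - w + k)) (b := (1 - w) / (1 - w + k)) (by positivity)
    (div_nonneg (by linarith [hw.2]) hD.le) (by field_simp; ring)
  simp only [Prod.smul_mk, Prod.mk_add_mk, smul_eq_mul, Set.mem_ofPred_eq] at hconv
  have hone : k / (1 - w + k) * w + (1 - w) / (1 - w + k) * (1 + k) = 1 := by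
    field_simp
    ring
  rw [hone, hφ.map_one] at hconv
  have hreal : 1 ≤ k / (1 - w + k) * p + (1 - w) / (1 - w + k) * c := by
    exact_mod_cast hconv
  have hmul : 1 - w + k ≤ k * p + (1 - w) * c := by
    have := mul_le_mul_of_nonneg_left hreal hD.le
    rw [mul_one] at this
    refine this.trans (le_of_eq ?_)
    field_simp
  have habs : (1 - w) * (c - 1) ≤ (1 - w) * |c - 1| :=
    mul_le_mul_of_nonneg_left (le_abs_self _) (by linarith [hw.2])
  have hrw : 1 - |c - 1| / k * (1 - w) = 1 - (1 - w) * |c - 1| / k := by ring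
  rw [hrw, sub_le_iff_le_add, ← sub_le_iff_le_add', le_div_iff₀ hk]
  nlinarith

end IsSurrogate

section Objective

variable {n m : ℕ} {E : Submodule ℝ (Matrix (Fin n) (Fin m) ℝ)}

lemma sv_mem_Icc (hnm : n ≤ m) {W : Matrix (Fin n) (Fin m) ℝ} (hW : spectralNorm W ≤ 1) {i : ℕ}
    (hi : i < n) : sv W i ∈ Set.Icc (0 : ℝ) 1 :=
  ⟨sv_nonneg W i, (sv_le_spectralNorm hnm W hi).trans hW⟩

lemma ereal_coe_sum {ι : Type*} (s : Finset ι) (g : ι → ℝ) :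
    ((∑ i ∈ s, g i : ℝ) : EReal) = ∑ i ∈ s, (g i : EReal) :=
  map_sum (⟨⟨Real.toEReal, EReal.coe_zero⟩, EReal.coe_add⟩ : ℝ →+ EReal) g s

lemma mpecObjective_eq_coe (hnm : n ≤ m) {Ω : Set E} {f : E → EReal}
    (hf : ∀ X ∈ Ω, f X ≠ ⊥ ∧ f X ≠ ⊤) {φ : ℝ → EReal} (hφ : IsSurrogate φ) (ν : ℝ) {X W : E}
    (hX : X ∈ Ω) (hW : spectralNorm W.1 ≤ 1) :
    mpecObjective f ν φ X W =
      (((f X).toReal + ν * ∑ i ∈ Finset.range n, (φ (sv W.1 i)).toReal : ℝ) : EReal) := by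
  have hsum : ∑ i ∈ Finset.range n, φ (sv W.1 i) =
      ((∑ i ∈ Finset.range n, (φ (sv W.1 i)).toReal : ℝ) : EReal) := by
    rw [ereal_coe_sum]
    exact Finset.sum_congr rfl fun i hi =>
      (hφ.coe_toReal (sv_mem_Icc hnm hW (Finset.mem_range.1 hi))).symm
  rw [mpecObjective, hsum, EReal.coe_add, EReal.coe_mul, EReal.coe_toReal (hf X hX).2 (hf X hX).1]

/-- For `X` of rank at most `r` there is a feasible `W` whose penalty is `r`: give the first `r`
singular directions of `X` the coefficient `1`, where `φ` is `1`, and all others a minimizer of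
`φ`. -/
lemma exists_mem_mpecFeasible_zero (hE : IsMatrixSpace n m E) {Ω : Set E} {φ : ℝ → EReal}
    (hφ : IsSurrogate φ) {r : ℕ} (hr : r ≤ n) {X : E} (hX : X ∈ Ω)
    (hsv : ∀ i, r ≤ i → i < n → sv X.1 i = 0) :
    ∃ W : E, (X, W) ∈ mpecFeasible Ω 0 ∧
      ∑ i ∈ Finset.range n, (φ (sv W.1 i)).toReal = r := by
  obtain ⟨u, v, hu, hv, h, hmem⟩ := hE.exists_eq_dyadicSum_sv X.2
  obtain ⟨t, ht, -, h0⟩ := hφ.exists_min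
  set d : ℕ → ℝ := fun i => if i < r then 1 else t with hd
  have hdI : ∀ i, d i ∈ Set.Icc (0 : ℝ) 1 := by
    intro i
    simp only [hd]
    split_ifs
    · simp
    · exact ht
  have hda : Antitone d := by
    intro a b hab
    by_cases hb : b < r
    · simp [hd, hb, hab.trans_lt hb]
    · simpa [hd, hb] using (by split_ifs; exacts [ht.2, le_rfl] : t ≤ if a < r then 1 else t)
  have hsvd : ∀ i < n, sv (dyadicSum u v d) i = d i := fun i hi =>
    sv_dyadicSum hE.le hu hv hda (fun i => (hdI i).1) hi
  refine ⟨⟨dyadicSum u v d, hmem d⟩, ⟨hX, spectralNorm_dyadicSum_le_one hu hv hdI, ?_⟩, ?_⟩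
  · have htr : traceInner (dyadicSum u v d) X.1 = ∑ i : Fin n, sv X.1 i * d i := by
      conv_lhs => rw [h]
      rw [traceInner_dyadicSum]
      refine Finset.sum_congr rfl fun i _ => ?_
      rw [toEuclideanLin_dyadicSum_apply hv, inner_smul_left]
      simp [hu.1]
    rw [residual, htr, nuclearNorm, Finset.sum_range, sub_eq_zero]
    refine Finset.sum_congr rfl fun i _ => ?_
    by_cases hi : (i : ℕ) < r
    · simp [hd, hi]
    · simp [hsv i (not_lt.1 hi) i.2]
  · have hval : ∀ i < n, (φ (sv (dyadicSum u v d) i)).toReal = if i < r then 1 else 0 := by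
      intro i hi
      rw [hsvd i hi]
      simp only [hd]
      split_ifs
      · exact hφ.toReal_one
      · simp [h0]
    rw [Finset.sum_congr rfl fun i hi => hval i (Finset.mem_range.1 hi), ← Finset.sum_filter]
    have : (Finset.range n).filter (· < r) = Finset.range r := by
      ext i
      simp only [Finset.mem_filter, Finset.mem_range]
      omega
    simp [this]

end Objective

/-! ### Partial calmness -/

section PartialCalmness

variable {n m : ℕ} {E : Submodule ℝ (Matrix (Fin n) (Fin m) ℝ)}

/-- Local error bound for the rank constraint. For `1 ≤ r` it is calmness of the perturbed set; for
`r = 0` the reference point is the zero matrix, which is feasible, and the norm is at most the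
nuclear norm. -/
lemma exists_eventually_norm_sub_le (hE : IsMatrixSpace n m E) {Ω : Set E}
    (hcalm : ∀ r ∈ Finset.Icc 1 n, ∀ X ∈ rankSet Ω r, IsCalmAt (perturbedSet Ω r) (0 : ℝ) X)
    {Xs : E} (hXs : Xs ∈ Ω) {r : ℕ} (hr : Xs.1.rank = r) (hrn : r ≤ n) :
    ∃ γ : ℝ, 0 ≤ γ ∧ ∀ᶠ X in 𝓝 Xs, X ∈ Ω → ∃ Y ∈ Ω, (∀ i, r ≤ i → i < n → sv Y.1 i = 0) ∧
      ‖X - Y‖ ≤ γ * ∑ i ∈ Finset.Ico r n, sv X.1 i := by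
  rcases Nat.eq_zero_or_pos r with h0 | hpos
  · have hz : ∀ i, sv Xs.1 i = 0 := fun i => sv_eq_zero_iff.2 (by omega)
    have hX0 : Xs = 0 := by
      have := norm_le_nuclearNorm hE.le Xs.1
      simp only [nuclearNorm, hz, Finset.sum_const_zero] at this
      exact Subtype.ext (norm_le_zero_iff.1 this)
    refine ⟨1, zero_le_one, Filter.Eventually.of_forall fun X _ =>
      ⟨Xs, hXs, fun i _ _ => hz i, ?_⟩⟩
    rw [hX0, sub_zero, one_mul, h0, ← Finset.range_eq_Ico]
    exact norm_le_nuclearNorm hE.le X.1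
  · obtain ⟨γ, hγ, e, he, η, hη, H⟩ := hcalm r (Finset.mem_Icc.2 ⟨hpos, hrn⟩) Xs ⟨hXs, hr.le⟩
    have hcont : Continuous fun X : E => ∑ i ∈ Finset.Ico r n, sv X.1 i :=
      continuous_finsetSum _ fun i hi =>
        (continuous_sv hE.le (Finset.mem_Ico.1 hi).2).comp continuous_subtype_val
    have hval : ∑ i ∈ Finset.Ico r n, sv Xs.1 i = 0 := Finset.sum_eq_zero fun i hi =>
      sv_eq_zero_iff.2 (hr.le.trans (Finset.mem_Ico.1 hi).1)
    have hev : ∀ᶠ X in 𝓝 Xs, ∑ i ∈ Finset.Ico r n, sv X.1 i < e :=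
      hcont.continuousAt.eventually_lt_const (by simpa only [hval] using he)
    refine ⟨γ, hγ, ?_⟩
    filter_upwards [hev, Metric.closedBall_mem_nhds Xs hη] with X hXe hXη hX
    have hτ : 0 ≤ ∑ i ∈ Finset.Ico r n, sv X.1 i := Finset.sum_nonneg fun i _ => sv_nonneg _ i
    have hmem := H (∑ i ∈ Finset.Ico r n, sv X.1 i)
      (by rw [mem_closedBall_zero_iff, Real.norm_of_nonneg hτ]; exact hXe.le)
      ⟨⟨hX, nuclearNorm_sub_kyFanNorm hrn X.1⟩, hXη⟩
    rw [sub_zero, Real.norm_of_nonneg hτ] at hmem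
    obtain ⟨Y, ⟨hY, hY0⟩, b, ⟨c, hc, rfl⟩, hsum⟩ := hmem
    rw [nuclearNorm_sub_kyFanNorm hrn, Finset.sum_eq_zero_iff_of_nonneg
      fun i _ => sv_nonneg _ i] at hY0
    refine ⟨Y, hY, fun i h1 h2 => hY0 i (Finset.mem_Ico.2 ⟨h1, h2⟩), ?_⟩
    have hXY : X - Y = (γ * ∑ i ∈ Finset.Ico r n, sv X.1 i) • c :=
      sub_eq_iff_eq_add'.2 hsum.symm
    rw [hXY, norm_smul, Real.norm_of_nonneg (mul_nonneg hγ hτ)]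
    exact mul_le_of_le_one_right (mul_nonneg hγ hτ) (mem_closedBall_zero_iff.1 hc)

/-- At a global solution the singular values of `W` equal `1` up to the rank of `X`, and are below
`1` from there on: since `X` only needs `rank X` unit singular values, the others are minimizers
of `φ`. -/
lemma IsGlobalSolution.sv_eq_one_and_lt_one (hE : IsMatrixSpace n m E) {Ω : Set E} {f : E → EReal}
    (hf : ∀ X ∈ Ω, f X ≠ ⊥ ∧ f X ≠ ⊤) {ν : ℝ} (hν : 0 < ν) {φ : ℝ → EReal} (hφ : IsSurrogate φ)
    {Xs Ws : E} (hsol : IsGlobalSolution Ω f ν φ Xs Ws) :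
    (∀ i < Xs.1.rank, sv Ws.1 i = 1) ∧ ∀ i, Xs.1.rank ≤ i → i < n → sv Ws.1 i < 1 := by
  obtain ⟨⟨hXs, hWs, hres⟩, hmin⟩ := hsol
  have hrn : Xs.1.rank ≤ n := by simpa using Xs.1.rank_le_card_height
  have hI : ∀ i < n, sv Ws.1 i ∈ Set.Icc (0 : ℝ) 1 := fun i hi => sv_mem_Icc hE.le hWs hi
  have hone : ∀ i < Xs.1.rank, sv Ws.1 i = 1 := by
    have hle := sum_sv_mul_one_sub_sv_le_residual hE.le Xs Ws
    have hnn : ∀ i ∈ Finset.range n, 0 ≤ sv Xs.1 i * (1 - sv Ws.1 i) := fun i hi =>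
      mul_nonneg (sv_nonneg _ i) (sub_nonneg.2 (hI i (Finset.mem_range.1 hi)).2)
    have hz := (Finset.sum_eq_zero_iff_of_nonneg hnn).1
      (le_antisymm (hle.trans hres.le) (Finset.sum_nonneg hnn))
    intro i hi
    rcases mul_eq_zero.1 (hz i (Finset.mem_range.2 (hi.trans_le hrn))) with h | h
    · exact absurd (sv_eq_zero_iff.1 h) (not_le.2 hi)
    · linarith
  refine ⟨hone, fun i hri hin => lt_of_le_of_ne (hI i hin).2 fun hi1 => ?_⟩
  obtain ⟨W, hW, hsum⟩ := exists_mem_mpecFeasible_zero hE hφ hrn hXs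
    fun i h1 _ => sv_eq_zero_iff.2 h1
  have hle := hmin Xs W hW
  rw [mpecObjective_eq_coe hE.le hf hφ ν hXs hWs, mpecObjective_eq_coe hE.le hf hφ ν hXs hW.2.1,
    EReal.coe_le_coe_iff, hsum] at hle
  have hle' := le_of_mul_le_mul_left (le_of_add_le_add_left hle) hν
  have hsplit := Finset.sum_range_add_sum_Ico (fun i => (φ (sv Ws.1 i)).toReal) hrn
  have hfirst : ∑ i ∈ Finset.range Xs.1.rank, (φ (sv Ws.1 i)).toReal = Xs.1.rank := by
    rw [Finset.sum_congr rfl fun i hi => by rw [hone i (Finset.mem_range.1 hi), hφ.toReal_one]]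
    simp
  have hsecond : (φ (sv Ws.1 i)).toReal ≤
      ∑ i ∈ Finset.Ico Xs.1.rank n, (φ (sv Ws.1 i)).toReal :=
    Finset.single_le_sum (f := fun i => (φ (sv Ws.1 i)).toReal)
      (fun j hj => hφ.toReal_nonneg (hI j (Finset.mem_Ico.1 hj).2))
      (Finset.mem_Ico.2 ⟨hri, hin⟩)
  rw [hi1, hφ.toReal_one] at hsecond
  linarith

/-- The first `r` singular values of `X` and the last `n - r` values of `1 - sv W` being bounded
away from zero, the residual controls both the tail of `sv X` and the defect of `sv W` from `1`. -/
lemma mul_sum_add_sum_le_residual (hnm : n ≤ m) {X W : E} (hW : spectralNorm W.1 ≤ 1) {r : ℕ}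
    (hrn : r ≤ n) {κ : ℝ} (hX : ∀ i < r, κ ≤ sv X.1 i)
    (hWκ : ∀ i, r ≤ i → i < n → sv W.1 i ≤ 1 - κ) :
    κ * (∑ i ∈ Finset.range r, (1 - sv W.1 i) + ∑ i ∈ Finset.Ico r n, sv X.1 i) ≤
      residual X W := by
  refine le_trans ?_ (sum_sv_mul_one_sub_sv_le_residual hnm X W)
  rw [← Finset.sum_range_add_sum_Ico _ hrn, mul_add, Finset.mul_sum, Finset.mul_sum]
  refine add_le_add (Finset.sum_le_sum fun i hi => ?_) (Finset.sum_le_sum fun i hi => ?_)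
  · have hi := Finset.mem_range.1 hi
    exact mul_le_mul_of_nonneg_right (hX i hi)
      (sub_nonneg.2 (sv_mem_Icc hnm hW (hi.trans_le hrn)).2)
  · obtain ⟨h1, h2⟩ := Finset.mem_Ico.1 hi
    rw [mul_comm]
    exact mul_le_mul_of_nonneg_left (by linarith [hWκ i h1 h2]) (sv_nonneg _ i)

/-- Near a global solution the bounds of `mul_sum_add_sum_le_residual` hold with one constant. -/
lemma IsGlobalSolution.exists_eventually_sv_bounds (hE : IsMatrixSpace n m E) {Ω : Set E}
    {f : E → EReal} (hf : ∀ X ∈ Ω, f X ≠ ⊥ ∧ f X ≠ ⊤) {ν : ℝ} (hν : 0 < ν) {φ : ℝ → EReal}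
    (hφ : IsSurrogate φ) {Xs Ws : E} (hsol : IsGlobalSolution Ω f ν φ Xs Ws) :
    ∃ κ : ℝ, 0 < κ ∧ (∀ᶠ X in 𝓝 Xs, ∀ i < Xs.1.rank, κ ≤ sv X.1 i) ∧
      ∀ᶠ W in 𝓝 Ws, ∀ i, Xs.1.rank ≤ i → i < n → sv W.1 i ≤ 1 - κ := by
  have hrn : Xs.1.rank ≤ n := by simpa using Xs.1.rank_le_card_height
  have hlt := (hsol.sv_eq_one_and_lt_one hE hf hν hφ).2
  -- Both families of singular values are antitone, so a single index is decisive in each.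
  obtain ⟨κ₁, hκ₁, h₁⟩ : ∃ κ > 0, ∀ i < Xs.1.rank, κ < sv Xs.1 i := by
    rcases Nat.eq_zero_or_pos Xs.1.rank with h0 | hpos
    · exact ⟨1, one_pos, by simp [h0]⟩
    · have hp : 0 < sv Xs.1 (Xs.1.rank - 1) := lt_of_le_of_ne (sv_nonneg _ _) fun h => by
        have := sv_eq_zero_iff.1 h.symm
        omega
      exact ⟨_, half_pos hp, fun i hi =>
        (half_lt_self hp).trans_le (sv_antitone Xs.1 (Nat.le_sub_one_of_lt hi))⟩
  obtain ⟨κ₂, hκ₂, h₂⟩ : ∃ κ > 0, ∀ i, Xs.1.rank ≤ i → i < n → sv Ws.1 i < 1 - κ := by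
    rcases hrn.eq_or_lt with h | h
    · exact ⟨1, one_pos, fun i h1 h2 => by omega⟩
    · have hp := hlt _ le_rfl h
      refine ⟨(1 - sv Ws.1 Xs.1.rank) / 2, by linarith, fun i h1 _ => ?_⟩
      linarith [sv_antitone Ws.1 h1]
  refine ⟨min κ₁ κ₂, lt_min hκ₁ hκ₂, ?_, ?_⟩
  · refine (Set.finite_Iio Xs.1.rank).eventually_all.2 fun i hi => ?_
    have hc : Continuous fun X : E => sv X.1 i :=
      (continuous_sv hE.le (lt_of_lt_of_le hi hrn)).comp continuous_subtype_val
    filter_upwards [hc.continuousAt.eventually_const_lt (h₁ i hi)] with X hX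
    exact (min_le_left _ _).trans hX.le
  · have : ∀ᶠ W in 𝓝 Ws, ∀ i ∈ Set.Ico Xs.1.rank n, sv W.1 i ≤ 1 - min κ₁ κ₂ := by
      refine (Set.finite_Ico Xs.1.rank n).eventually_all.2 fun i hi => ?_
      have hc : Continuous fun W : E => sv W.1 i :=
        (continuous_sv hE.le hi.2).comp continuous_subtype_val
      filter_upwards [hc.continuousAt.eventually_lt_const (h₂ i hi.1 hi.2)] with W hW
      linarith [min_le_right κ₁ κ₂]
    exact this.mono fun W hW i h1 h2 => hW i ⟨h1, h2⟩

/-- The penalty of `W` is at least `r` up to a multiple of the defect of its first `r` singular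
values from `1`. -/
lemma IsSurrogate.sub_le_sum_toReal (hnm : n ≤ m) {φ : ℝ → EReal} (hφ : IsSurrogate φ) {L : ℝ}
    (hL : ∀ w ∈ Set.Icc (0 : ℝ) 1, 1 - L * (1 - w) ≤ (φ w).toReal)
    {W : Matrix (Fin n) (Fin m) ℝ} (hW : spectralNorm W ≤ 1) {r : ℕ} (hrn : r ≤ n) :
    r - L * ∑ i ∈ Finset.range r, (1 - sv W i) ≤
      ∑ i ∈ Finset.range n, (φ (sv W i)).toReal := by
  rw [← Finset.sum_range_add_sum_Ico _ hrn]
  have h1 : ∑ i ∈ Finset.range r, (1 - L * (1 - sv W i)) ≤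
      ∑ i ∈ Finset.range r, (φ (sv W i)).toReal := Finset.sum_le_sum fun i hi =>
    hL _ (sv_mem_Icc hnm hW ((Finset.mem_range.1 hi).trans_le hrn))
  have h2 : 0 ≤ ∑ i ∈ Finset.Ico r n, (φ (sv W i)).toReal := Finset.sum_nonneg fun i hi =>
    hφ.toReal_nonneg (sv_mem_Icc hnm hW (Finset.mem_Ico.1 hi).2)
  rw [Finset.sum_sub_distrib, ← Finset.mul_sum] at h1
  simp only [Finset.sum_const, Finset.card_range, nsmul_eq_mul, mul_one] at h1
  linarith

/-- Near a global solution, `f` decreases by at most a multiple of the tail of the singular values: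
the value at a nearby point of rank at most that of the solution is no smaller than the
optimal one. -/
lemma IsGlobalSolution.exists_eventually_le_toReal (hE : IsMatrixSpace n m E) {Ω : Set E}
    {f : E → EReal} (hLip : IsLocallyLipschitzFiniteOn f Ω) {ν : ℝ} {φ : ℝ → EReal}
    (hφ : IsSurrogate φ)
    (hcalm : ∀ r ∈ Finset.Icc 1 n, ∀ X ∈ rankSet Ω r, IsCalmAt (perturbedSet Ω r) (0 : ℝ) X)
    {Xs Ws : E} (hsol : IsGlobalSolution Ω f ν φ Xs Ws) :
    ∃ C : ℝ, 0 ≤ C ∧ ∀ᶠ X in 𝓝 Xs, X ∈ Ω →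
      (f Xs).toReal + ν * ∑ i ∈ Finset.range n, (φ (sv Ws.1 i)).toReal ≤
        (f X).toReal + ν * Xs.1.rank + C * ∑ i ∈ Finset.Ico Xs.1.rank n, sv X.1 i := by
  obtain ⟨⟨hXs, hWs, hres⟩, hmin⟩ := hsol
  have hrn : Xs.1.rank ≤ n := by simpa using Xs.1.rank_le_card_height
  obtain ⟨γ, hγ, hev⟩ := exists_eventually_norm_sub_le hE hcalm hXs rfl hrn
  obtain ⟨K, t, ht, hK⟩ := hLip.2 hXs
  obtain ⟨e, he, hball⟩ := Metric.mem_nhdsWithin_iff.1 ht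
  have hcont : Continuous fun X : E => γ * ∑ i ∈ Finset.Ico Xs.1.rank n, sv X.1 i :=
    continuous_const.mul (continuous_finsetSum _ fun i hi =>
      (continuous_sv hE.le (Finset.mem_Ico.1 hi).2).comp continuous_subtype_val)
  have hval : γ * ∑ i ∈ Finset.Ico Xs.1.rank n, sv Xs.1 i = 0 := by
    rw [Finset.sum_eq_zero fun i hi => sv_eq_zero_iff.2 (Finset.mem_Ico.1 hi).1, mul_zero]
  have hev' : ∀ᶠ X in 𝓝 Xs, γ * ∑ i ∈ Finset.Ico Xs.1.rank n, sv X.1 i < e / 2 :=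
    hcont.continuousAt.eventually_lt_const (by simpa only [hval] using half_pos he)
  refine ⟨K * γ, mul_nonneg K.2 hγ, ?_⟩
  filter_upwards [hev, hev', Metric.ball_mem_nhds Xs (half_pos he)] with X hX1 hX2 hX3 hX
  obtain ⟨Y, hY, hYsv, hXY⟩ := hX1 hX
  have hXt : X ∈ t := hball ⟨Metric.ball_subset_ball (half_le_self he.le) hX3, hX⟩
  have hYt : Y ∈ t := by
    refine hball ⟨?_, hY⟩
    have h1 := dist_triangle_left Y Xs X
    rw [Metric.mem_ball, dist_eq_norm] at hX3
    rw [dist_eq_norm X Y, dist_eq_norm X Xs] at h1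
    rw [Metric.mem_ball]
    linarith
  have hfXY := hK.dist_le_mul Y hYt X hXt
  rw [Real.dist_eq, dist_comm, dist_eq_norm] at hfXY
  have hfXY' := (le_abs_self _).trans (hfXY.trans (mul_le_mul_of_nonneg_left hXY K.2))
  obtain ⟨W, hW, hsum⟩ := exists_mem_mpecFeasible_zero hE hφ hrn hY hYsv
  have hopt := hmin Y W hW
  rw [mpecObjective_eq_coe hE.le hLip.1 hφ ν hXs hWs,
    mpecObjective_eq_coe hE.le hLip.1 hφ ν hY hW.2.1, EReal.coe_le_coe_iff, hsum] at hopt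
  rw [← mul_assoc] at hfXY'
  linarith

end PartialCalmness

end RankReg

theorem lemma4p1 {n m : ℕ} (E : Submodule ℝ (Matrix (Fin n) (Fin m) ℝ))
    (hE : RankReg.IsMatrixSpace n m E)
    (Ω : Set E) (hΩ : IsClosed Ω)
    (f : E → EReal) (hbdd : ∃ c : ℝ, ∀ X : E, (c : EReal) ≤ f X)
    (hLip : RankReg.IsLocallyLipschitzFiniteOn f Ω)
    (hcoercive : RankReg.IsCoerciveFun (fun X : E => f X + RankReg.indicatorFun Ω X))
    (ν : ℝ) (hν : 0 < ν)
    (φ : ℝ → EReal) (hφ : RankReg.IsSurrogate φ)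
    (hcalm : ∀ r ∈ Finset.Icc 1 n, ∀ X ∈ RankReg.rankSet Ω r,
      RankReg.IsCalmAt (RankReg.perturbedSet Ω r) (0 : ℝ) X) :
    ∀ Xs Ws : E, RankReg.IsGlobalSolution Ω f ν φ Xs Ws →
      RankReg.IsPartiallyCalmAt Ω f ν φ Xs Ws := by
  intro Xs Ws hsol
  have hrn : Xs.1.rank ≤ n := by simpa using Xs.1.rank_le_card_height
  obtain ⟨κ, hκ, hX, hW⟩ := hsol.exists_eventually_sv_bounds hE hLip.1 hν hφ
  obtain ⟨L, hL0, hL⟩ := hφ.exists_one_sub_le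
  obtain ⟨C, hC, hf⟩ := hsol.exists_eventually_le_toReal hE hLip hφ hcalm
  obtain ⟨δ₁, hδ₁, hball₁⟩ := Metric.eventually_nhds_iff.1 (hX.and hf)
  obtain ⟨δ₂, hδ₂, hball₂⟩ := Metric.eventually_nhds_iff.1 hW
  have hδ : 0 < min δ₁ δ₂ / 2 := half_pos (lt_min hδ₁ hδ₂)
  refine ⟨min δ₁ δ₂ / 2, hδ, (C / ν + L) / κ + 1, by positivity, fun ε hε X W hdist hfeas => ?_⟩
  obtain ⟨hXΩ, hW1, hres⟩ := hfeas
  have hdX : ‖X - Xs‖ ≤ min δ₁ δ₂ / 2 :=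
    le_of_sq_le_sq (by linarith [sq_nonneg ‖W - Ws‖]) hδ.le
  have hdW : ‖W - Ws‖ ≤ min δ₁ δ₂ / 2 :=
    le_of_sq_le_sq (by linarith [sq_nonneg ‖X - Xs‖]) hδ.le
  obtain ⟨hX1, hX2⟩ := hball₁ (y := X) (by
    rw [dist_eq_norm]; linarith [min_le_left δ₁ δ₂])
  have hW2 := hball₂ (y := W) (by
    rw [dist_eq_norm]; linarith [min_le_right δ₁ δ₂])
  have hkey := RankReg.mul_sum_add_sum_le_residual hE.le hW1 hrn hX1 hW2
  have hpen := hφ.sub_le_sum_toReal hE.le hL hW1 hrn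
  have hfX := hX2 hXΩ
  rw [RankReg.mpecObjective_eq_coe hE.le hLip.1 hφ ν hXΩ hW1,
    RankReg.mpecObjective_eq_coe hE.le hLip.1 hφ ν hsol.1.1 hsol.1.2.1]
  set A := ∑ i ∈ Finset.range Xs.1.rank, (1 - RankReg.sv W.1 i)
  set B := ∑ i ∈ Finset.Ico Xs.1.rank n, RankReg.sv X.1 i
  have hA : 0 ≤ A := Finset.sum_nonneg fun i hi => sub_nonneg.2
    (RankReg.sv_mem_Icc hE.le hW1 ((Finset.mem_range.1 hi).trans_le hrn)).2
  have hB : 0 ≤ B := Finset.sum_nonneg fun i _ => RankReg.sv_nonneg _ i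
  have hR : 0 ≤ RankReg.residual X W := hres ▸ hε
  have hAB : A + B ≤ RankReg.residual X W / κ := by
    rw [le_div_iff₀ hκ]
    linarith
  have hpen' := mul_le_mul_of_nonneg_left hpen hν.le
  have h1 : C * B + ν * (L * A) ≤ (C + ν * L) * (RankReg.residual X W / κ) := by
    have hs : 0 ≤ C + ν * L := by positivity
    refine le_trans ?_ (mul_le_mul_of_nonneg_left hAB hs)
    nlinarith [mul_nonneg hC hA, mul_nonneg (mul_nonneg hν.le hL0) hB]
  have h2 : ((C / ν + L) / κ + 1) * ν * RankReg.residual X W =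
      (C + ν * L) * (RankReg.residual X W / κ) + ν * RankReg.residual X W := by
    field_simp
  have h3 : 0 ≤ ν * RankReg.residual X W := mul_nonneg hν.le hR
  rw [← EReal.coe_sub, ← EReal.coe_add, EReal.coe_nonneg, h2]
  linarith
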